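/- Let $X$ be a scheme and let $\mathfrak{Qcoh}(X)$ be the category of quasi-coherent sheaves of $\mathcal O_X$-modules on $X$. Call an object $\mathscr H$ of $\mathfrak{Qcoh}(X)$ finitely presented if $\mathrm{Hom}(\mathscr H,-)$ preserves direct limits in $\mathfrak{Qcoh}(X)$. A short exact sequence $0\to\mathscr F'\to\mathscr G\to\mathscr F\to 0$ in $\mathfrak{Qcoh}(X)$ is called pure exact if $\mathscr M\otimes\mathscr F'\to\mathscr M\otimes\mathscr G$ is a monomorphism for every sheaf of $\mathcal O_X$-modules $\mathscr M$ (quasi-coherent or not), and categorical pure if $\mathrm{Hom}(\mathscr H,-)$ leaves it exact for every finitely presented object $\mathscr H$ of $\mathfrak{Qcoh}(X)$. A quasi-coherent sheaf $\mathscr F$ is called tensor flat (respectively fp-flat) if every short exact sequence in $\mathfrak{Qcoh}(X)$ ending in $\mathscr F$ is pure exact (respectively categorical pure), and flat if $\mathscr F\otimes -$ is an exact functor on the category of all sheaves of $\mathcal O_X$-modules. Let $\mathcal Flat_{\otimes}$, $\mathcal Flat_{fp}$ and $\mathcal Flat$ be the classes of tensor flat, fp-flat and flat quasi-coherent sheaves.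 Assume that $\mathfrak{Qcoh}(X)$ is locally finitely presented, that is, it has direct limits, its finitely presented objects form a class with a small skeleton, and each of its objects is a direct limit of finitely presented objects. Then $\mathcal Flat_{fp}\subseteq\mathcal Flat_{\otimes}$. If moreover $X$ is semi-separated (the intersection of any two affine open subsets of $X$ is affine), then $\mathcal Flat_{fp}\subseteq\mathcal Flat_{\otimes}=\mathcal Flat$. -/

import Mathlib

universe u

open CategoryTheory Limits AlgebraicGeometry Opposite MonoidalCategory

noncomputable section

namespace QcohPurity

/-- The category of quasi-coherent sheaves on `X`, as a full subcategory of the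
category `X.Modules` of all sheaves of `𝒪_X`-modules. -/
abbrev Qcoh (X : Scheme.{u}) : Type (u + 1) :=
  ObjectProperty.FullSubcategory (C := X.Modules)
    (fun M => SheafOfModules.IsQuasicoherent M)

/-- The inclusion of `Qcoh X` in `X.Modules`. -/
abbrev Qcoh.incl (X : Scheme.{u}) : Qcoh X ⥤ X.Modules :=
  ObjectProperty.ι (C := X.Modules) (fun M => SheafOfModules.IsQuasicoherent M)

/-- A category is locally finitely presented (in the sense of Crawley-Boevey) if it has direct
limits, the finitely presented objects have a small skeleton, and each object is a direct limit
of finitely presented objects. -/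
structure IsLocallyFinitelyPresented (A : Type (u + 1)) [Category.{u} A] : Prop where
  hasFilteredColimits : HasFilteredColimitsOfSize.{u, u} A
  essentiallySmall :
    ObjectProperty.EssentiallySmall.{u} (ObjectProperty.isFinitelyPresentable.{u} A)
  exists_isColimit (M : A) :
    ∃ (J : Type u) (_ : SmallCategory J) (_ : IsFiltered J) (D : J ⥤ A) (c : Cocone D)
      (_ : IsColimit c), (∀ j, IsFinitelyPresentable.{u} (D.obj j)) ∧ Nonempty (c.pt ≅ M)

/-- A scheme is semi-separated if the intersection of any two affine open subsets is affine. -/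
def IsSemiSeparated (X : Scheme.{u}) : Prop :=
  ∀ U V : X.Opens, IsAffineOpen U → IsAffineOpen V → IsAffineOpen (U ⊓ V)

/-- The sheafification functor from presheaves of `𝒪_X`-modules to sheaves of `𝒪_X`-modules. -/
def sheafify (X : Scheme.{u}) : X.PresheafOfModules ⥤ X.Modules :=
  PresheafOfModules.sheafification (𝟙 X.ringCatSheaf.obj)

/-- The functor `Q ↦ P ⊗ Q` on presheaves of `𝒪_X`-modules, where `P ⊗ Q` is the presheaf
`U ↦ P(U) ⊗ Q(U)`, the tensor product being over `𝒪_X(U)`. -/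
def presheafTensor {X : Scheme.{u}} (P : X.PresheafOfModules) :
    X.PresheafOfModules ⥤ X.PresheafOfModules :=
  tensorLeft (C := PresheafOfModules.{u} (X.presheaf ⋙ forget₂ CommRingCat RingCat)) P

/-- The functor `N ↦ M ⊗ N` on sheaves of `𝒪_X`-modules: `M ⊗ N` is the sheafification of the
presheaf `U ↦ M(U) ⊗ N(U)`, the tensor product being over `𝒪_X(U)`. -/
def tensorFunctor {X : Scheme.{u}} (M : X.Modules) : X.Modules ⥤ X.Modules :=
  Scheme.Modules.toPresheafOfModules X ⋙
    presheafTensor ((Scheme.Modules.toPresheafOfModules X).obj M) ⋙ sheafify X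

variable {X : Scheme.{u}}

/-- A short exact sequence `0 ⟶ F ⟶ G ⟶ T ⟶ 0` in `Qcoh X` is pure exact if
`M ⊗ F ⟶ M ⊗ G` is a monomorphism for every sheaf of `𝒪_X`-modules `M`, quasi-coherent or not. -/
def IsPureExact (S : ShortComplex (Qcoh X)) : Prop :=
  S.ShortExact ∧ ∀ M : X.Modules, Mono ((tensorFunctor M).map ((Qcoh.incl X).map S.f))

/-- A short exact sequence in `Qcoh X` is categorical pure if `Hom(H, -)` leaves it exact for each
finitely presented object `H` of `Qcoh X`. -/
def IsCategoricalPure (S : ShortComplex (Qcoh X)) : Prop :=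
  S.ShortExact ∧ ∀ H : Qcoh X, IsFinitelyPresentable.{u} H →
    (S.map (preadditiveCoyoneda.obj (op H))).ShortExact

variable (X)

/-- The class of tensor flat quasi-coherent sheaves: every short exact sequence in `Qcoh X`
ending in `F` is pure exact. -/
def FlatTensor : Set (Qcoh X) :=
  {F | ∀ S : ShortComplex (Qcoh X), S.ShortExact → S.X₃ = F → IsPureExact S}

/-- The class of fp-flat quasi-coherent sheaves: every short exact sequence in `Qcoh X`
ending in `F` is categorical pure. -/
def FlatFp : Set (Qcoh X) :=
  {F | ∀ S : ShortComplex (Qcoh X), S.ShortExact → S.X₃ = F → IsCategoricalPure S}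

/-- The class of flat quasi-coherent sheaves: `F ⊗ -` is an exact functor on `X.Modules`. -/
def Flat : Set (Qcoh X) :=
  {F | exactFunctor X.Modules X.Modules (tensorFunctor F.obj)}

end QcohPurity

end

namespace QcohPurity

section Algebra

open TensorProduct

theorem exists_sum_tmul_of_span_eq_top {R M N : Type*} [CommRing R] [AddCommGroup M]
    [AddCommGroup N] [Module R M] [Module R N] {l : ℕ} (m : Fin l → M)
    (hm : Submodule.span R (Set.range m) = ⊤) (t : M ⊗[R] N) :
    ∃ x : Fin l → N, t = ∑ i, m i ⊗ₜ x i := by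
  induction t with
  | zero => exact ⟨0, by simp⟩
  | tmul a b =>
    obtain ⟨c, rfl⟩ := (Submodule.mem_span_range_iff_exists_fun R).1 (hm ▸ Submodule.mem_top (x := a))
    exact ⟨fun i ↦ c i • b, by simp [TensorProduct.sum_tmul, TensorProduct.smul_tmul]⟩
  | add a b ha hb =>
    obtain ⟨x, rfl⟩ := ha
    obtain ⟨y, rfl⟩ := hb
    exact ⟨x + y, by simp [TensorProduct.tmul_add, Finset.sum_add_distrib]⟩

/-- If every finite homogeneous linear system over `R` that has a solution in `F` made of elements
of the range of `g : G → F` can be lifted to a solution in `G`, then the kernel of `g` is a pure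
submodule of `G`. -/
theorem lTensor_injective_of_lift_relations {R K G F : Type*} [CommRing R] [AddCommGroup K]
    [AddCommGroup G] [AddCommGroup F] [Module R K] [Module R G] [Module R F]
    (f : K →ₗ[R] G) (g : G →ₗ[R] F) (hf : Function.Injective f) (hfg : Function.Exact f g)
    (hlift : ∀ (l k : ℕ) (a : Fin l → Fin k → R) (y : Fin k → G),
      (∀ i, ∑ j, a i j • g (y j) = 0) →
        ∃ z : Fin k → G, (∀ j, g (z j) = g (y j)) ∧ ∀ i, ∑ j, a i j • z j = 0)
    (M : Type*) [AddCommGroup M] [Module R M] : Function.Injective (f.lTensor M) := by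
  rw [injective_iff_map_eq_zero]
  intro t ht
  obtain ⟨J, hJ, t, rfl⟩ := Submodule.exists_fg_le_eq_rTensor_subtype t
  have ht' : J.subtype.rTensor G (f.lTensor J t) = J.subtype.rTensor G 0 := by
    rw [map_zero, ← ht, ← LinearMap.comp_apply, ← LinearMap.comp_apply,
      LinearMap.lTensor_comp_rTensor, LinearMap.rTensor_comp_lTensor]
  obtain ⟨J', hJ', hle, ht'⟩ := hJ.exists_rTensor_fg_inclusion_eq ht'
  suffices h : (J.inclusion hle).rTensor K t = 0 by
    have : J.subtype.rTensor K t = J'.subtype.rTensor K ((J.inclusion hle).rTensor K t) := by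
      rw [← LinearMap.comp_apply, ← LinearMap.rTensor_comp]; rfl
    rw [this, h, map_zero]
  have ht2 : f.lTensor J' ((J.inclusion hle).rTensor K t) = 0 := by
    rw [map_zero] at ht'
    rw [← ht', ← LinearMap.comp_apply, ← LinearMap.comp_apply,
      LinearMap.lTensor_comp_rTensor, LinearMap.rTensor_comp_lTensor]
  generalize (J.inclusion hle).rTensor K t = t at ht2
  have := Module.Finite.of_fg hJ'
  obtain ⟨l, m, hm⟩ := Module.Finite.exists_fin (R := R) (M := J')
  obtain ⟨x, rfl⟩ := exists_sum_tmul_of_span_eq_top m hm t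
  simp only [map_sum, LinearMap.lTensor_tmul] at ht2
  obtain ⟨k, a, y, hy, ha⟩ := TensorProduct.vanishesTrivially_of_sum_tmul_eq_zero R hm ht2
  obtain ⟨z, hz, hz'⟩ := hlift l k a y fun i ↦ by
    have h := hfg.apply_apply_eq_zero (x i)
    rw [show f (x i) = _ from hy i, map_sum] at h
    simpa only [map_smul] using h
  have hw (j : Fin k) : ∃ w, f w = y j - z j := (hfg _).1 (by simp [hz])
  choose w hw using hw
  refine TensorProduct.sum_tmul_eq_zero_of_vanishesTrivially R ⟨k, a, w, fun i ↦ hf ?_, ha⟩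
  simp [hy, hw, smul_sub, hz']

/-- A quotient of a flat module by a submodule which stays injective after tensoring with
all cyclic modules is flat. -/
theorem flat_of_lTensor_quotient_injective {R K G F : Type*} [CommRing R] [AddCommGroup K]
    [AddCommGroup G] [AddCommGroup F] [Module R K] [Module R G] [Module R F] [Module.Flat R G]
    (f : K →ₗ[R] G) (g : G →ₗ[R] F) (hfg : Function.Exact f g) (hg : Function.Surjective g)
    (hpure : ∀ I : Ideal R, Function.Injective (f.lTensor (R ⧸ I))) : Module.Flat R F := by
  rw [Module.Flat.iff_rTensor_injective]
  intro I _
  rw [injective_iff_map_eq_zero]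
  intro t ht
  obtain ⟨t, rfl⟩ := LinearMap.lTensor_surjective I hg t
  have h1 : g.lTensor R (I.subtype.rTensor G t) = 0 := by
    rw [← ht, ← LinearMap.comp_apply, ← LinearMap.comp_apply, LinearMap.lTensor_comp_rTensor,
      LinearMap.rTensor_comp_lTensor]
  obtain ⟨s, hs⟩ := (lTensor_exact R hfg hg _).1 h1
  have h2 : (Submodule.mkQ I).rTensor K s = 0 := by
    apply hpure I
    rw [map_zero, ← LinearMap.comp_apply, LinearMap.lTensor_comp_rTensor,
      ← LinearMap.rTensor_comp_lTensor, LinearMap.comp_apply, hs, ← LinearMap.comp_apply,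
      ← LinearMap.rTensor_comp, (LinearMap.exact_subtype_mkQ I).linearMap_comp_eq_zero,
      LinearMap.rTensor_zero, LinearMap.zero_apply]
  obtain ⟨r, rfl⟩ := (rTensor_exact K (LinearMap.exact_subtype_mkQ I)
    (Submodule.mkQ_surjective I) _).1 h2
  have h3 : f.lTensor I r = t := by
    apply Module.Flat.rTensor_preserves_injective_linearMap (M := G) I.subtype I.subtype_injective
    rw [← hs, ← LinearMap.comp_apply, ← LinearMap.comp_apply, LinearMap.lTensor_comp_rTensor,
      LinearMap.rTensor_comp_lTensor]
  rw [← h3, ← LinearMap.comp_apply, ← LinearMap.lTensor_comp, hfg.linearMap_comp_eq_zero]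
  simp

/-- An element of `M ⊗ N` which vanishes after localizing both factors away from `r` is killed by
a power of `r`. -/
theorem exists_pow_smul_eq_zero_of_tensor_localization {R A M N M' N' : Type*} [CommRing R]
    [CommRing A] [Algebra R A] (r : R) [IsLocalization.Away r A] [AddCommGroup M] [AddCommGroup N]
    [AddCommGroup M'] [AddCommGroup N'] [Module R M] [Module R N] [Module R M'] [Module R N']
    [Module A M'] [Module A N'] [IsScalarTower R A M'] [IsScalarTower R A N']
    (f : M →ₗ[R] M') (g : N →ₗ[R] N') [IsLocalizedModule (.powers r) f]
    [IsLocalizedModule (.powers r) g] (ψ : M ⊗[R] N →+ M' ⊗[A] N')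
    (hψ : ∀ m n, ψ (m ⊗ₜ n) = f m ⊗ₜ g n) (t : M ⊗[R] N) (ht : ψ t = 0) :
    ∃ n : ℕ, r ^ n • t = 0 := by
  have h (t : M ⊗[R] N) :
      IsLocalization.moduleTensorEquiv (.powers r) A M' N' (ψ t) = TensorProduct.map f g t := by
    induction t with
    | zero => simp
    | tmul a b => rw [hψ]; rfl
    | add a b ha hb => simp [ha, hb]
  have h0 := h t
  rw [ht, map_zero] at h0
  obtain ⟨⟨_, n, rfl⟩, hn⟩ :=
    (IsLocalizedModule.eq_zero_iff (.powers r) (TensorProduct.map f g)).1 h0.symm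
  exact ⟨n, hn⟩

end Algebra
end QcohPurity

namespace QcohPurity

noncomputable section

section Localizing

variable {X : Scheme.{u}}

/-- The sections of `M` over an open set `U` localize to the sections over the basic open sets
of `U`. -/
structure IsLocalizingOn (M : X.Modules) (U : X.Opens) : Prop where
  exists_lift (f : Γ(X, U)) (s : Γ(M, X.basicOpen f)) : ∃ (n : ℕ) (t : Γ(M, U)),
    M.presheaf.map (homOfLE (X.basicOpen_le f)).op t =
      X.presheaf.map (homOfLE (X.basicOpen_le f)).op f ^ n • s
  exists_pow_smul (f : Γ(X, U)) (t : Γ(M, U)) :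
    M.presheaf.map (homOfLE (X.basicOpen_le f)).op t = 0 → ∃ n : ℕ, f ^ n • t = 0

variable {U : X.Opens} (hU : IsAffineOpen U)

/-- The sections of the restriction of `M` along `Spec Γ(X, U) ⟶ X`. -/
def restrictFromSpecIso (M : X.Modules) {V : (Spec Γ(X, U)).Opens} {W : X.Opens}
    (h : W = hU.fromSpec ''ᵁ V) : Γ(M.restrict hU.fromSpec, V) ≅ Γ(M, W) :=
  M.restrictAppIso hU.fromSpec V ≪≫ M.presheaf.mapIso (eqToIso h).op

lemma fromSpec_appIso_inv (V : (Spec Γ(X, U)).Opens) (h : hU.fromSpec ''ᵁ V ≤ U) :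
    (Scheme.ΓSpecIso Γ(X, U)).inv ≫ (Spec Γ(X, U)).presheaf.map V.leTop.op ≫
      (hU.fromSpec.appIso V).inv = X.presheaf.map (homOfLE h).op := by
  rw [← Category.assoc, Iso.comp_inv_eq, Scheme.Hom.appIso_hom']
  rw [Scheme.Hom.map_appLE, Scheme.Hom.appLE, hU.fromSpec_app_self]
  simp only [Category.assoc, ← Functor.map_comp]
  rfl

lemma restrictFromSpecIso_smul (M : X.Modules) {V : (Spec Γ(X, U)).Opens} {W : X.Opens}
    (h : W = hU.fromSpec ''ᵁ V) (hW : W ≤ U) (r : Γ(X, U)) (x : Γ(M.restrict hU.fromSpec, V)) :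
    (restrictFromSpecIso hU M h).hom (r • x) =
      X.presheaf.map (homOfLE hW).op r • (restrictFromSpecIso hU M h).hom x := by
  subst h
  simp only [restrictFromSpecIso, Scheme.Modules.smul_Spec_def]
  simp only [eqToIso_refl, Iso.op_refl, Functor.mapIso_refl, Iso.trans_refl,
    Scheme.Modules.smul_restrictAppIso_hom_apply]
  congr 1
  exact congr($(fromSpec_appIso_inv hU V hW) r)

lemma restrictFromSpecIso_map (M : X.Modules) {V V' : (Spec Γ(X, U)).Opens} {W W' : X.Opens}
    (h : W = hU.fromSpec ''ᵁ V) (h' : W' = hU.fromSpec ''ᵁ V') (hV : V ≤ V') (hW : W ≤ W')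
    (x : Γ(M.restrict hU.fromSpec, V')) :
    (restrictFromSpecIso hU M h).hom ((M.restrict hU.fromSpec).presheaf.map (homOfLE hV).op x) =
      M.presheaf.map (homOfLE hW).op ((restrictFromSpecIso hU M h').hom x) := by
  subst h h'
  simp [restrictFromSpecIso]

theorem isLocalizingOn_iff_isLocalizing (M : X.Modules) :
    IsLocalizingOn M U ↔
      IsLocalizing (modulesSpecToSheaf.obj (M.restrict hU.fromSpec)) := by
  have hT : U = hU.fromSpec ''ᵁ ⊤ := by
    rw [Scheme.Hom.image_top_eq_opensRange, hU.opensRange_fromSpec]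
  let B (f : Γ(X, U)) : (Spec Γ(X, U)).Opens := PrimeSpectrum.basicOpen f
  have hB (f : Γ(X, U)) : X.basicOpen f = hU.fromSpec ''ᵁ B f :=
    (hU.fromSpec_image_basicOpen f).symm
  let eT := restrictFromSpecIso hU M hT
  let eB (f : Γ(X, U)) := restrictFromSpecIso hU M (hB f)
  have hsT (r : Γ(X, U)) (x) : eT.hom (r • x) = r • eT.hom x := by
    refine (restrictFromSpecIso_smul hU M hT le_rfl r x).trans ?_
    congr 1
    exact congr($(X.presheaf.map_id _) r)
  have hsB (f : Γ(X, U)) (n : ℕ) (x) : (eB f).hom (f ^ n • x) =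
      X.presheaf.map (homOfLE (X.basicOpen_le f)).op f ^ n • (eB f).hom x :=
    (restrictFromSpecIso_smul hU M (hB f) (X.basicOpen_le f) (f ^ n) x).trans (by rw [map_pow])
  have hm (f : Γ(X, U)) (x) :
      (eB f).hom ((M.restrict hU.fromSpec).presheaf.map (homOfLE le_top).op x) =
        M.presheaf.map (homOfLE (X.basicOpen_le f)).op (eT.hom x) :=
    restrictFromSpecIso_map hU M (hB f) hT le_top (X.basicOpen_le f) x
  refine ⟨fun h f ↦ IsLocalizedModule.Away.mk_of_addCommGroup ?_ ?_ ?_, fun h ↦ ⟨?_, ?_⟩⟩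
  · exact Scheme.Modules.isUnit_algebraMap_end_of_le_basicOpen f le_rfl
  · intro x
    obtain ⟨n, t, ht⟩ := h.exists_lift f ((eB f).hom x)
    refine ⟨n, eT.inv t, ?_⟩
    apply (ConcreteCategory.bijective_of_isIso (eB f).hom).1
    refine (hsB f n x).trans (ht.symm.trans (Eq.trans ?_ (hm f (eT.inv t)).symm))
    simp
  · intro x hx
    obtain ⟨n, hn⟩ := h.exists_pow_smul f (eT.hom x)
      ((hm f x).symm.trans ((congr_arg (eB f).hom hx).trans (map_zero _)))
    refine ⟨n, (ConcreteCategory.bijective_of_isIso eT.hom).1 ?_⟩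
    exact (hsT _ _).trans (hn.trans (map_zero _).symm)
  · intro f s
    obtain ⟨⟨y, ⟨_, n, rfl⟩⟩, hy⟩ := (h f).surj ((eB f).inv s)
    refine ⟨n, eT.hom y, ?_⟩
    refine (hm f y).symm.trans ((congr_arg (eB f).hom hy.symm).trans ((hsB f n _).trans ?_))
    simp
  · intro f t ht
    obtain ⟨⟨_, n, rfl⟩, hn⟩ := (IsLocalizedModule.eq_zero_iff (.powers f)
      ((modulesSpecToSheaf.obj (M.restrict hU.fromSpec)).obj.map
        (PrimeSpectrum.basicOpen f).leTop.op).hom (m := eT.inv t)).1 (by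
          apply (ConcreteCategory.bijective_of_isIso (eB f).hom).1
          refine (hm f (eT.inv t)).trans (Eq.trans ?_ (map_zero _).symm)
          simpa using ht)
    refine ⟨n, ?_⟩
    have := (hsT (f ^ n) (eT.inv t)).symm.trans ((congr_arg eT.hom hn).trans (map_zero _))
    simpa using this

theorem IsLocalizingOn.of_isQuasicoherent (M : X.Modules) [M.IsQuasicoherent]
    (hU : IsAffineOpen U) : IsLocalizingOn M U := by
  rw [isLocalizingOn_iff_isLocalizing hU, ← isIso_fromTildeΓ_iff_isLocalizing]
  exact Scheme.Modules.isIso_fromTildeΓ_of_isQuasicoherent _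

theorem nonempty_presentation_of_isIso_fromTildeΓ {R : CommRingCat.{u}} (M : (Spec R).Modules)
    (h : IsIso M.fromTildeΓ) : Nonempty (SheafOfModules.Presentation.{u, u, u} M) :=
  haveI : IsIso (C := SheafOfModules (Spec R).ringCatSheaf) M.fromTildeΓ := h
  ⟨SheafOfModules.Presentation.ofIsIso.{u, u, u} M.fromTildeΓ
    (presentationTilde.{u} _ .univ (by simp) _ (Submodule.span_eq _))⟩

theorem nonempty_presentation_over (M : X.Modules) (hU : IsAffineOpen U)
    (h : IsIso (M.restrict hU.fromSpec).fromTildeΓ) :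
    Nonempty (SheafOfModules.Presentation (SheafOfModules.over M U)) := by
  obtain ⟨p⟩ := nonempty_presentation_of_isIso_fromTildeΓ (M.restrict hU.fromSpec) h
  let F : SheafOfModules.{u} (Spec Γ(X, U)).ringCatSheaf ⥤
      SheafOfModules.{u} (X.ringCatSheaf.over U) :=
    Scheme.Modules.restrictFunctor hU.isoSpec.hom ⋙ (Scheme.Modules.overEquiv U).inverse
  let e : F.obj (M.restrict hU.fromSpec) ≅ SheafOfModules.over M U :=
    (Scheme.Modules.overEquiv U).inverse.mapIso
      ((Scheme.Modules.restrictFunctorComp hU.isoSpec.hom hU.fromSpec).symm.app M ≪≫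
        (Scheme.Modules.restrictFunctorCongr hU.isoSpec_hom_fromSpec).app M ≪≫
        (Scheme.Modules.overFunctorEquiv U).symm.app M) ≪≫
      ((Scheme.Modules.overEquiv U).unitIso.app _).symm
  let η : SheafOfModules.unit (X.ringCatSheaf.over U) ≅
      F.obj (SheafOfModules.unit (Spec Γ(X, U)).ringCatSheaf) :=
    (Scheme.Modules.overEquiv U).unitIso.app _ ≪≫ (Scheme.Modules.overEquiv U).inverse.mapIso
      (Scheme.Modules.restrictUnitIso hU.isoSpec.hom).symm
  have : PreservesColimitsOfSize.{u, u} F := comp_preservesColimits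
    (Scheme.Modules.restrictFunctor hU.isoSpec.hom) (Scheme.Modules.overEquiv U).inverse
  exact ⟨SheafOfModules.Presentation.ofIsIso.{u, u, u} e.hom (p.map F η)⟩

theorem isQuasicoherent_of_isLocalizingOn (M : X.Modules)
    (h : ∀ U : X.Opens, IsAffineOpen U → IsLocalizingOn M U) :
  M.IsQuasicoherent := by
  have h' (U : X.affineOpens) : Nonempty (SheafOfModules.Presentation (SheafOfModules.over M U.1)) :=
    nonempty_presentation_over M U.2 ((isIso_fromTildeΓ_iff_isLocalizing _).2
      ((isLocalizingOn_iff_isLocalizing U.2 M).1 (h _ U.2)))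
  refine SheafOfModules.QuasicoherentData.isQuasicoherent.{u, u, u, u} (M := M)
    { I := X.affineOpens
      X := fun U ↦ U.1
      coversTop := ?_
      presentation := fun U ↦ (h' U).some }
  rw [Opens.coversTop_iff]
  exact iSup_affineOpens_eq_top X

end Localizing
end

end QcohPurity

namespace QcohPurity

noncomputable section

section Closure

/-- Quasi-coherence, as a property of objects of `X.Modules`. -/
abbrev qcoh (X : Scheme.{u}) : ObjectProperty X.Modules := fun M ↦ M.IsQuasicoherent

variable {X : Scheme.{u}}

/-- The functor of sections over an open set. -/
abbrev sections (U : X.Opens) : X.Modules ⥤ Ab.{u} :=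
  Scheme.Modules.toPresheaf X ⋙ (evaluation _ _).obj (op U)

instance (U : X.Opens) : PreservesLimits (sections U) :=
  have : PreservesLimits ((evaluation (TopologicalSpace.Opens X)ᵒᵖ Ab.{u}).obj (op U)) :=
    { preservesLimitsOfShape := inferInstance }
  comp_preservesLimits _ _

theorem app_map_apply {M N : X.Modules} (φ : M ⟶ N) {U V : X.Opens} (h : V ≤ U) (t : Γ(M, U)) :
    φ.app V (M.presheaf.map (homOfLE h).op t) = N.presheaf.map (homOfLE h).op (φ.app U t) :=
  congr($(φ.mapPresheaf.naturality (homOfLE h).op) t)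

theorem map_smul_homOfLE (M : X.Modules) {U V : X.Opens} (h : V ≤ U) (r : Γ(X, U)) (t : Γ(M, U)) :
    M.presheaf.map (homOfLE h).op (r • t) =
      X.presheaf.map (homOfLE h).op r • M.presheaf.map (homOfLE h).op t :=
  M.map_smul (homOfLE h) r t

theorem exists_of_isLimit_of_compatible {J : Type*} [Category J] {F : J ⥤ Ab.{u}} {c : Cone F}
    [PreservesLimit F (forget Ab.{u})]
    (hc : IsLimit c) (x : ∀ j, F.obj j) (hx : ∀ {i j} (f : i ⟶ j), F.map f (x i) = x j) :
    ∃ y : c.pt, ∀ j, c.π.app j y = x j := by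
  let s : (F ⋙ forget Ab).sections := ⟨x, fun f ↦ hx f⟩
  let h := Types.isLimitEquivSections (isLimitOfPreserves (forget Ab) hc)
  refine ⟨h.symm s, fun j ↦ ?_⟩
  exact Types.isLimitEquivSections_symm_apply (isLimitOfPreserves (forget Ab) hc) s j

theorem IsLocalizingOn.of_isLimit {J : Type} [SmallCategory J] [FinCategory J]
    {D : J ⥤ X.Modules} {c : Cone D} (hc : IsLimit c) {U : X.Opens}
    (h : ∀ j, IsLocalizingOn (D.obj j) U) : IsLocalizingOn c.pt U where
  exists_lift f s := by
    have hV : X.basicOpen f ≤ U := X.basicOpen_le f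
    choose n t ht using fun j ↦ (h j).exists_lift f ((c.π.app j).app _ s)
    have hle (j : J) : n j ≤ ∑ i, n i := Finset.single_le_sum (by simp) (Finset.mem_univ j)
    let t' (j : J) : Γ(D.obj j, U) := f ^ (∑ i, n i - n j) • t j
    have ht' (j : J) : (D.obj j).presheaf.map (homOfLE hV).op (t' j) =
        X.presheaf.map (homOfLE hV).op f ^ (∑ i, n i) • (c.π.app j).app _ s := by
      rw [map_smul_homOfLE, ht, map_pow, smul_smul, ← pow_add, Nat.sub_add_cancel (hle j)]
    have hcomp (p : Σ i j : J, i ⟶ j) :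
        ∃ m : ℕ, f ^ m • ((D.map p.2.2).app U (t' p.1) - t' p.2.1) = 0 := by
      apply (h p.2.1).exists_pow_smul
      rw [map_sub, ← app_map_apply, ht', ht', Scheme.Modules.Hom.app_smul, sub_eq_zero,
        ← c.w p.2.2]
      rfl
    choose m hm using hcomp
    have hle' (p : Σ i j : J, i ⟶ j) : m p ≤ ∑ i, m i :=
      Finset.single_le_sum (by simp) (Finset.mem_univ p)
    obtain ⟨y, hy⟩ := exists_of_isLimit_of_compatible (isLimitOfPreserves (sections U) hc)
      (fun j ↦ f ^ (∑ i, m i) • t' j) (fun {i j} α ↦ by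
        have h1 := hm ⟨i, j, α⟩
        rw [smul_sub, sub_eq_zero] at h1
        refine ((D.map α).app_smul _ _).trans ?_
        rw [← Nat.sub_add_cancel (hle' ⟨i, j, α⟩), pow_add, mul_smul, mul_smul]
        exact congr_arg _ h1)
    refine ⟨∑ i, m i + ∑ i, n i, y, ?_⟩
    apply Concrete.isLimit_ext _ (isLimitOfPreserves (sections (X.basicOpen f)) hc)
    intro j
    refine (app_map_apply (c.π.app j) hV y).trans ?_
    refine (congr_arg _ (hy j)).trans ?_
    rw [map_smul_homOfLE, ht', map_pow, smul_smul, ← pow_add]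
    exact ((c.π.app j).app_smul _ _).symm
  exists_pow_smul f t ht := by
    choose n hn using fun j ↦ (h j).exists_pow_smul f ((c.π.app j).app _ t)
      ((app_map_apply (c.π.app j) _ t).symm.trans ((congr_arg _ ht).trans (map_zero _)))
    have hle (j : J) : n j ≤ ∑ i, n i := Finset.single_le_sum (by simp) (Finset.mem_univ j)
    refine ⟨∑ j, n j, ?_⟩
    apply Concrete.isLimit_ext _ (isLimitOfPreserves (sections U) hc)
    intro j
    refine ((c.π.app j).app_smul _ _).trans (Eq.trans ?_ (map_zero _).symm)
    rw [← Nat.sub_add_cancel (hle j), pow_add, mul_smul, hn, smul_zero]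

instance {J : Type} [SmallCategory J] [FinCategory J] : (qcoh X).IsClosedUnderLimitsOfShape J where
  limitsOfShape_le := by
    rintro M ⟨p⟩
    refine isQuasicoherent_of_isLocalizingOn _ fun U hU ↦ ?_
    exact IsLocalizingOn.of_isLimit p.isLimit fun j ↦
      have := p.prop_diag_obj j
      .of_isQuasicoherent _ hU

instance : PreservesFiniteLimits (Qcoh.incl X) where
  preservesFiniteLimits J _ _ :=
    inferInstanceAs (PreservesLimitsOfShape J (qcoh X).ι)

instance {J : Type u} [SmallCategory J] : (qcoh X).IsClosedUnderColimitsOfShape J where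
  colimitsOfShape_le := by
    rintro M ⟨p⟩
    refine isQuasicoherent_of_isLocalizingOn _ fun U hU ↦ ?_
    rw [isLocalizingOn_iff_isLocalizing hU, ← isIso_fromTildeΓ_iff_isLocalizing,
      isIso_fromTildeΓ_iff]
    have : (tilde.functor Γ(X, U)).essImage.IsClosedUnderColimitsOfShape J :=
      have : PreservesColimitsOfShape J (tilde.functor Γ(X, U)) := inferInstance
      have : HasColimitsOfShape J (ModuleCat.{u} Γ(X, U)) := inferInstance
      inferInstance
    refine ObjectProperty.prop_of_isColimit _
      (isColimitOfPreserves (Scheme.Modules.restrictFunctor hU.fromSpec) p.isColimit) fun j ↦ ?_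
    have := p.prop_diag_obj j
    exact isIso_fromTildeΓ_iff.1 (Scheme.Modules.isIso_fromTildeΓ_of_isQuasicoherent
      ((p.diag.obj j).restrict hU.fromSpec))

instance : PreservesColimitsOfSize.{u, u} (Qcoh.incl X) where
  preservesColimitsOfShape {J} _ :=
    inferInstanceAs (PreservesColimitsOfShape J (qcoh X).ι)

variable {U : X.Opens} (hU : IsAffineOpen U)

/-- The module of sections of a quasi-coherent sheaf over an affine open set. -/
def affineSections : Qcoh X ⥤ ModuleCat.{u} Γ(X, U) :=
  (Qcoh.incl X ⋙ Scheme.Modules.restrictFunctor hU.fromSpec) ⋙ moduleSpecΓFunctor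

/-- A quasi-coherent sheaf on an affine open set is associated with its module of sections. -/
def affineSectionsTildeIso : affineSections hU ⋙ tilde.functor Γ(X, U) ≅
    Qcoh.incl X ⋙ Scheme.Modules.restrictFunctor hU.fromSpec :=
  NatIso.ofComponents
    (fun F ↦
      have := F.property
      @asIso _ _ _ _ (F.obj.restrict hU.fromSpec).fromTildeΓ
        (Scheme.Modules.isIso_fromTildeΓ_of_isQuasicoherent (F.obj.restrict hU.fromSpec)))
    (fun φ ↦ Scheme.Modules.fromTildeΓNatTrans.naturality
      ((Scheme.Modules.restrictFunctor hU.fromSpec).map φ.hom))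

instance : PreservesColimitsOfSize.{u, u} (affineSections hU) :=
  have : PreservesColimitsOfSize.{u, u}
      (Qcoh.incl X ⋙ Scheme.Modules.restrictFunctor hU.fromSpec) := comp_preservesColimits _ _
  have : PreservesColimitsOfSize.{u, u} (affineSections hU ⋙ tilde.functor Γ(X, U)) :=
    preservesColimits_of_natIso (affineSectionsTildeIso hU).symm
  preservesColimits_of_reflects_of_preserves _ (tilde.functor Γ(X, U))

lemma eq_fromSpec_image_top : U = hU.fromSpec ''ᵁ ⊤ := by
  rw [Scheme.Hom.image_top_eq_opensRange, hU.opensRange_fromSpec]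

/-- The underlying abelian group of `affineSections`. -/
def affineSectionsForgetIso : affineSections hU ⋙ forget₂ (ModuleCat.{u} Γ(X, U)) Ab.{u} ≅
    Qcoh.incl X ⋙ sections U :=
  NatIso.ofComponents (fun F ↦ restrictFromSpecIso hU F.obj (eq_fromSpec_image_top hU)) (by
    intro F G φ
    ext x
    exact congr($(φ.hom.mapPresheaf.naturality
      (eqToHom (eq_fromSpec_image_top hU)).op) x).symm)

theorem preservesColimitsOfShape_sections (hU : IsAffineOpen U) {J : Type u} [SmallCategory J] :
    PreservesColimitsOfShape J (Qcoh.incl X ⋙ sections U) :=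
  have : PreservesColimitsOfShape J
      (affineSections hU ⋙ forget₂ (ModuleCat.{u} Γ(X, U)) Ab.{u}) :=
    comp_preservesColimitsOfShape _ _
  preservesColimitsOfShape_of_natIso (affineSectionsForgetIso hU)

theorem app_surjective_of_epi (hU : IsAffineOpen U) {F G : Qcoh X} (φ : F ⟶ G) [Epi φ] :
    Function.Surjective (φ.hom.app U) := by
  have : Epi ((Qcoh.incl X ⋙ sections U).map φ) :=
    have : PreservesFiniteColimits (Qcoh.incl X ⋙ sections U) :=
      have : PreservesColimitsOfSize.{u, u} (Qcoh.incl X ⋙ sections U) :=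
        ⟨preservesColimitsOfShape_sections hU⟩
      PreservesColimitsOfSize.preservesFiniteColimits _
    inferInstance
  exact (AddCommGrpCat.epi_iff_surjective _).1 this

instance : PreservesFiniteColimits (Qcoh.incl X) :=
  PreservesColimitsOfSize.preservesFiniteColimits.{u, u} _

theorem shortExact_incl {S : ShortComplex (Qcoh X)} (hS : S.ShortExact) :
    (S.map (Qcoh.incl X)).ShortExact :=
  hS.map_of_exact _

theorem app_injective_of_mono {M N : X.Modules} (φ : M ⟶ N) [Mono φ] (U : X.Opens) :
    Function.Injective (φ.app U) :=
  (AddCommGrpCat.mono_iff_injective _).1 (inferInstanceAs (Mono ((sections U).map φ)))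

instance (U : X.Opens) : (sections U).Additive where
  map_add := rfl

theorem exact_app {S : ShortComplex X.Modules} (hS : S.Exact) [Mono S.f] (U : X.Opens) :
    Function.Exact (S.f.app U) (S.g.app U) :=
  (ShortComplex.ab_exact_iff_function_exact _).1
    (hS.map_of_mono_of_preservesKernel (sections U) inferInstance inferInstance)

theorem IsLocalizingOn.exists_lift_of_eq {M : X.Modules} {U W : X.Opens} (h : IsLocalizingOn M U)
    (f : Γ(X, U)) (hW : W = X.basicOpen f) (hWU : W ≤ U) (s : Γ(M, W)) :
    ∃ (n : ℕ) (t : Γ(M, U)), M.presheaf.map (homOfLE hWU).op t =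
      X.presheaf.map (homOfLE hWU).op f ^ n • s := by
  subst hW
  exact h.exists_lift f s

theorem IsLocalizingOn.exists_pow_smul_of_eq {M : X.Modules} {U W : X.Opens}
    (h : IsLocalizingOn M U) (f : Γ(X, U)) (hW : W = X.basicOpen f) (hWU : W ≤ U) (t : Γ(M, U))
    (ht : M.presheaf.map (homOfLE hWU).op t = 0) : ∃ n : ℕ, f ^ n • t = 0 := by
  subst hW
  exact h.exists_pow_smul f t ht

theorem pushforward_smul_eq {Y : Scheme.{u}} (j : Y ⟶ X) (M : Y.Modules) {V : X.Opens}
    (r : Γ(X, V)) (s : Γ((Scheme.Modules.pushforward j).obj M, V)) :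
    r • s = (j.app V r • (show Γ(M, j ⁻¹ᵁ V) from s) : Γ(M, j ⁻¹ᵁ V)) :=
  rfl

theorem isLocalizingOn_pushforward {Y : Scheme.{u}} (j : Y ⟶ X) (M : Y.Modules) {V : X.Opens}
    (h : IsLocalizingOn M (j ⁻¹ᵁ V)) :
    IsLocalizingOn ((Scheme.Modules.pushforward j).obj M) V where
  exists_lift f s := by
    obtain ⟨n, t, ht⟩ := h.exists_lift_of_eq (j.app V f)
      (W := j ⁻¹ᵁ X.basicOpen f) (Scheme.preimage_basicOpen ..)
      (j.preimage_mono (X.basicOpen_le f)) s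
    refine ⟨n, t, ht.trans ?_⟩
    rw [pushforward_smul_eq, map_pow]
    congr 2
    exact congr($(j.naturality (homOfLE (X.basicOpen_le f)).op) f).symm
  exists_pow_smul f t ht := by
    obtain ⟨n, hn⟩ := h.exists_pow_smul_of_eq (j.app V f)
      (W := j ⁻¹ᵁ X.basicOpen f) (Scheme.preimage_basicOpen ..)
      (j.preimage_mono (X.basicOpen_le f)) t ht
    refine ⟨n, ?_⟩
    rw [pushforward_smul_eq, map_pow]
    exact hn

theorem isAffineOpen_fromSpec_preimage (hX : IsSemiSeparated X) {U V : X.Opens}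
    (hU : IsAffineOpen U) (hV : IsAffineOpen V) : IsAffineOpen (hU.fromSpec ⁻¹ᵁ V) := by
  rw [← hU.fromSpec.isAffineOpen_iff_of_isOpenImmersion,
    Scheme.Hom.image_preimage_eq_opensRange_inf, hU.opensRange_fromSpec]
  exact hX U V hU hV

theorem isQuasicoherent_pushforward_fromSpec (hX : IsSemiSeparated X) {U : X.Opens}
    (hU : IsAffineOpen U) (M : (Spec Γ(X, U)).Modules) [M.IsQuasicoherent] :
    ((Scheme.Modules.pushforward hU.fromSpec).obj M).IsQuasicoherent :=
  isQuasicoherent_of_isLocalizingOn _ fun _ hV ↦ isLocalizingOn_pushforward _ _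
    (.of_isQuasicoherent _ (isAffineOpen_fromSpec_preimage hX hU hV))

end Closure
end
end QcohPurity

namespace QcohPurity

noncomputable section

section Sheafification

variable {X : Scheme.{u}}

instance : (sheafify X).IsLeftAdjoint :=
  inferInstanceAs (PresheafOfModules.sheafification (𝟙 X.ringCatSheaf.obj)).IsLeftAdjoint

instance : PreservesFiniteLimits (sheafify X) :=
  inferInstanceAs (PreservesFiniteLimits (PresheafOfModules.sheafification (𝟙 X.ringCatSheaf.obj)))

instance : (sheafify X).Additive :=
  Functor.additive_of_preserves_binary_products _

theorem exists_affine_le {x : X} {U : X.Opens} (hx : x ∈ U) :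
    ∃ V : X.Opens, IsAffineOpen V ∧ x ∈ V ∧ V ≤ U := by
  obtain ⟨_, ⟨V, hV, rfl⟩, hxV, hVU⟩ := X.isBasis_affineOpens.exists_subset_of_mem_open hx U.2
  exact ⟨V, hV, hxV, hVU⟩

variable {P Q : X.PresheafOfModules} (φ : P ⟶ Q)

theorem mono_sheafify_map (h : ∀ U : X.Opens, IsAffineOpen U → Function.Injective (φ.app (op U))) :
    Mono ((sheafify X).map φ) := by
  have : Presheaf.IsLocallyInjective (Opens.grothendieckTopology X)
      ((PresheafOfModules.toPresheaf _).map φ) := by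
    refine ⟨fun {U} x y hxy ↦ fun z hz ↦ ?_⟩
    obtain ⟨V, hV, hzV, hVU⟩ := exists_affine_le hz
    refine ⟨V, homOfLE hVU, ?_, hzV⟩
    apply h V hV
    have hxy' : φ.app U x = φ.app U y := hxy
    exact (PresheafOfModules.naturality_apply φ (homOfLE hVU).op x).trans
      ((congr_arg (Q.map (homOfLE hVU).op) hxy').trans
        (PresheafOfModules.naturality_apply φ (homOfLE hVU).op y).symm)
  rw [← Presheaf.isLocallyInjective_presheafToSheaf_map_iff] at this
  exact (SheafOfModules.toSheaf X.ringCatSheaf).mono_of_mono_map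
    (Sheaf.mono_of_isLocallyInjective ((presheafToSheaf (Opens.grothendieckTopology X) Ab.{u}).map
      ((PresheafOfModules.toPresheaf _).map φ)))

theorem epi_sheafify_map (h : ∀ (U : X.Opens) (t : Q.obj (op U)) (x : X), x ∈ U →
      ∃ (V : X.Opens) (hV : V ≤ U), x ∈ V ∧ ∃ s : P.obj (op V),
        φ.app (op V) s = Q.map (homOfLE hV).op t) :
    Epi ((sheafify X).map φ) := by
  have : Presheaf.IsLocallySurjective (Opens.grothendieckTopology X)
      ((PresheafOfModules.toPresheaf _).map φ) := by
    refine ⟨fun {U} t ↦ fun z hz ↦ ?_⟩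
    obtain ⟨V, hVU, hzV, s, hs⟩ := h U t z hz
    exact ⟨V, homOfLE hVU, ⟨s, hs⟩, hzV⟩
  rw [← Presheaf.isLocallySurjective_presheafToSheaf_map_iff] at this
  exact (SheafOfModules.toSheaf X.ringCatSheaf).epi_of_epi_map
    (Sheaf.epi_of_isLocallySurjective
      ((presheafToSheaf (Opens.grothendieckTopology X) Ab.{u}).map
        ((PresheafOfModules.toPresheaf _).map φ)))

/-- The canonical map from a presheaf of modules to its sheafification. -/
def toSheafifyApp (P : X.PresheafOfModules) (U : X.Opens) :
    (P.presheaf.obj (op U)) ⟶ ((sheafify X).obj P).presheaf.obj (op U) :=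
  (toSheafify (Opens.grothendieckTopology X) P.presheaf).app (op U)

theorem toSheafifyApp_naturality (U : X.Opens) (t : P.obj (op U)) :
    toSheafifyApp Q U (φ.app (op U) t) =
      ((sheafify X).map φ).app U (toSheafifyApp P U t) :=
  congr($(NatTrans.congr_app (toSheafify_naturality (Opens.grothendieckTopology X)
    ((PresheafOfModules.toPresheaf _).map φ)) (op U)) t)

theorem exists_map_eq_zero_of_toSheafifyApp_eq_zero {U : X.Opens} (t : P.obj (op U))
    (ht : toSheafifyApp P U t = 0) {x : X} (hx : x ∈ U) :
    ∃ (V : X.Opens) (hV : V ≤ U), x ∈ V ∧ P.map (homOfLE hV).op t = 0 := by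
  have h : Presheaf.IsLocallyInjective (Opens.grothendieckTopology X)
      (toSheafify (Opens.grothendieckTopology X) P.presheaf) := inferInstance
  obtain ⟨V, i, hi, hxV⟩ := h.equalizerSieve_mem (X := op U) t 0
    (ht.trans (map_zero ((toSheafify (Opens.grothendieckTopology X)
      P.presheaf).app (op U)).hom).symm) x hx
  exact ⟨V, i.le, hxV, Eq.trans hi (map_zero (P.presheaf.map i.op).hom)⟩

theorem exists_map_eq_zero_of_mono_sheafify_map [Mono ((sheafify X).map φ)] {U : X.Opens}
    (t : P.obj (op U)) (ht : φ.app (op U) t = 0) {x : X} (hx : x ∈ U) :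
    ∃ (V : X.Opens) (hV : V ≤ U), x ∈ V ∧ P.map (homOfLE hV).op t = 0 := by
  apply exists_map_eq_zero_of_toSheafifyApp_eq_zero t _ hx
  apply app_injective_of_mono ((sheafify X).map φ) U
  rw [← toSheafifyApp_naturality, ht]
  exact (map_zero (toSheafifyApp Q U).hom).trans
    (map_zero (((sheafify X).map φ).app U).hom).symm

theorem exists_app_eq_map_of_epi_sheafify_map [Epi ((sheafify X).map φ)] {U : X.Opens}
    (t : Q.obj (op U)) {x : X} (hx : x ∈ U) :
    ∃ (V : X.Opens) (hV : V ≤ U), x ∈ V ∧ ∃ s : P.obj (op V),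
      φ.app (op V) s = Q.map (homOfLE hV).op t := by
  have h : (sheafify X).map (cokernel.π φ) = 0 := by
    rw [← cancel_epi ((sheafify X).map φ), ← Functor.map_comp, cokernel.condition,
      Functor.map_zero, comp_zero]
  obtain ⟨V, hV, hxV, hz⟩ := exists_map_eq_zero_of_toSheafifyApp_eq_zero
    (P := cokernel φ) ((cokernel.π φ).app (op U) t)
    (by rw [toSheafifyApp_naturality, h]; rfl) hx
  refine ⟨V, hV, hxV, ?_⟩
  have hex : (ShortComplex.mk φ (cokernel.π φ) (cokernel.condition φ)).Exact :=
    ShortComplex.exact_cokernel φ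
  have := (ShortComplex.ShortExact.moduleCat_exact_iff_function_exact _).1
    (hex.map (PresheafOfModules.evaluation _ (op V)))
  refine (this _).1 ?_
  exact (PresheafOfModules.naturality_apply (cokernel.π φ) (homOfLE hV).op t).trans hz

/-- A complex of presheaves of modules which is exact on affine open sets has an exact
sheafification. -/
theorem exact_map_sheafify (S : ShortComplex X.PresheafOfModules)
    (h : ∀ U : X.Opens, IsAffineOpen U → Function.Exact (S.f.app (op U)) (S.g.app (op U))) :
    (S.map (sheafify X)).Exact := by
  let S' : ShortComplex X.PresheafOfModules := ShortComplex.mk (kernel.ι S.g) S.g (kernel.condition _)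
  have hS' : S'.Exact := ShortComplex.exact_kernel S.g
  let α : S ⟶ S' :=
    { τ₁ := kernel.lift S.g S.f S.zero
      τ₂ := 𝟙 _
      τ₃ := 𝟙 _ }
  have : Epi ((sheafify X).map α.τ₁) := by
    apply epi_sheafify_map
    intro U t x hx
    obtain ⟨V, hV, hxV, hVU⟩ := exists_affine_le hx
    refine ⟨V, hVU, hxV, ?_⟩
    generalize (kernel S.g).map (homOfLE hVU).op t = t'
    have hinj : Function.Injective ((kernel.ι S.g).app (op V)) :=
      (ModuleCat.mono_iff_injective _).1
        (inferInstanceAs (Mono ((PresheafOfModules.evaluation _ (op V)).map (kernel.ι S.g))))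
    obtain ⟨s, hs⟩ := (h V hV ((kernel.ι S.g).app (op V) t')).1
      congr(($(kernel.condition S.g)).app (op V) t')
    refine ⟨s, hinj ?_⟩
    exact congr(($(kernel.lift_ι S.g S.f S.zero)).app (op V) s).trans hs
  have h1 : Epi ((sheafify X).mapShortComplex.map α).τ₁ := this
  have h2 : IsIso ((sheafify X).mapShortComplex.map α).τ₂ :=
    inferInstanceAs (IsIso ((sheafify X).map (𝟙 _)))
  have h3 : Mono ((sheafify X).mapShortComplex.map α).τ₃ :=
    inferInstanceAs (Mono ((sheafify X).map (𝟙 _)))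
  refine (ShortComplex.exact_iff_of_epi_of_isIso_of_mono
    ((sheafify X).mapShortComplex.map α)).2 ?_
  exact hS'.map (sheafify X)

end Sheafification

section Tensor

open TensorProduct

variable {X : Scheme.{u}}

/-- A morphism of sheaves of modules, on sections, as a linear map. -/
def appLin {M N : X.Modules} (φ : M ⟶ N) (U : X.Opens) : Γ(M, U) →ₗ[Γ(X, U)] Γ(N, U) where
  toFun := φ.app U
  map_add' := map_add _
  map_smul' := φ.app_smul

@[simp]
theorem appLin_apply {M N : X.Modules} (φ : M ⟶ N) (U : X.Opens) (x : Γ(M, U)) :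
    appLin φ U x = φ.app U x := rfl

/-- The tensor product of `𝒪_X`-modules, as presheaves. -/
abbrev presheafTensorObj (M N : X.Modules) : X.PresheafOfModules :=
  (presheafTensor ((Scheme.Modules.toPresheafOfModules X).obj M)).obj
    ((Scheme.Modules.toPresheafOfModules X).obj N)

/-- The tensor product of morphisms of `𝒪_X`-modules, as presheaves. -/
abbrev presheafTensorMap (M : X.Modules) {N N' : X.Modules} (φ : N ⟶ N') :
    presheafTensorObj M N ⟶ presheafTensorObj M N' :=
  (presheafTensor ((Scheme.Modules.toPresheafOfModules X).obj M)).map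
    ((Scheme.Modules.toPresheafOfModules X).map φ)

theorem presheafTensorObj_map_tmul (M N : X.Modules) {U V : X.Opens} (h : V ≤ U)
    (m : Γ(M, U)) (n : Γ(N, U)) :
    (presheafTensorObj M N).map (homOfLE h).op (m ⊗ₜ[Γ(X, U)] n) =
      M.presheaf.map (homOfLE h).op m ⊗ₜ[Γ(X, V)] N.presheaf.map (homOfLE h).op n :=
  rfl

theorem mono_tensorFunctor_map (M : X.Modules) {N N' : X.Modules} (φ : N ⟶ N')
    (h : ∀ U : X.Opens, IsAffineOpen U → Function.Injective ((appLin φ U).lTensor Γ(M, U))) :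
    Mono ((tensorFunctor M).map φ) :=
  mono_sheafify_map (presheafTensorMap M φ) h

theorem IsLocalizingOn.isLocalizedModule {M : X.Modules} {U : X.Opens} (h : IsLocalizingOn M U)
    (f : Γ(X, U)) [Module Γ(X, U) Γ(M, X.basicOpen f)]
    [IsScalarTower Γ(X, U) Γ(X, X.basicOpen f) Γ(M, X.basicOpen f)]
    (ρ : Γ(M, U) →ₗ[Γ(X, U)] Γ(M, X.basicOpen f))
    (hρ : ∀ x, ρ x = M.presheaf.map (homOfLE (X.basicOpen_le f)).op x) :
    IsLocalizedModule (.powers f) ρ := by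
  have hsmul (n : ℕ) (x : Γ(M, X.basicOpen f)) :
      f ^ n • x = X.presheaf.map (homOfLE (X.basicOpen_le f)).op f ^ n • x := by
    rw [← algebraMap_smul Γ(X, X.basicOpen f) (f ^ n) x, map_pow]
    rfl
  refine IsLocalizedModule.Away.mk_of_addCommGroup ?_ ?_ ?_
  · have hu : IsUnit (algebraMap Γ(X, U) Γ(X, X.basicOpen f) f) :=
      RingedSpace.isUnit_res_basicOpen _ f
    rw [Module.End.isUnit_iff]
    have := (Module.End.isUnit_iff _).1
      (hu.map (algebraMap _ (Module.End Γ(X, X.basicOpen f) Γ(M, X.basicOpen f))))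
    convert! this using 1
    ext x
    exact (algebraMap_smul Γ(X, X.basicOpen f) f x).symm
  · intro x
    obtain ⟨n, t, ht⟩ := h.exists_lift f x
    exact ⟨n, t, by rw [hρ, ht, hsmul]⟩
  · intro x hx
    exact h.exists_pow_smul f x (by rw [← hρ, hx])

theorem exists_pow_smul_eq_zero_of_map_eq_zero {M N : X.Modules} {U : X.Opens}
    (hU : IsAffineOpen U) (hM : IsLocalizingOn M U) (hN : IsLocalizingOn N U) (f : Γ(X, U))
    (t : Γ(M, U) ⊗[Γ(X, U)] Γ(N, U))
    (ht : (presheafTensorObj M N).map (homOfLE (X.basicOpen_le f)).op t = 0) :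
    ∃ n : ℕ, f ^ n • t = 0 := by
  have := hU.isLocalization_basicOpen f
  let _ : Module Γ(X, U) Γ(M, X.basicOpen f) :=
    Module.compHom _ (algebraMap Γ(X, U) Γ(X, X.basicOpen f))
  let _ : Module Γ(X, U) Γ(N, X.basicOpen f) :=
    Module.compHom _ (algebraMap Γ(X, U) Γ(X, X.basicOpen f))
  have : IsScalarTower Γ(X, U) Γ(X, X.basicOpen f) Γ(M, X.basicOpen f) :=
    .of_algebraMap_smul fun _ _ ↦ rfl
  have : IsScalarTower Γ(X, U) Γ(X, X.basicOpen f) Γ(N, X.basicOpen f) :=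
    .of_algebraMap_smul fun _ _ ↦ rfl
  let ρM : Γ(M, U) →ₗ[Γ(X, U)] Γ(M, X.basicOpen f) :=
    { toFun := M.presheaf.map (homOfLE (X.basicOpen_le f)).op
      map_add' := map_add _
      map_smul' := map_smul_homOfLE M _ }
  let ρN : Γ(N, U) →ₗ[Γ(X, U)] Γ(N, X.basicOpen f) :=
    { toFun := N.presheaf.map (homOfLE (X.basicOpen_le f)).op
      map_add' := map_add _
      map_smul' := map_smul_homOfLE N _ }
  have := hM.isLocalizedModule f ρM fun _ ↦ rfl
  have := hN.isLocalizedModule f ρN fun _ ↦ rfl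
  let ψ : Γ(M, U) ⊗[Γ(X, U)] Γ(N, U) →+
      Γ(M, X.basicOpen f) ⊗[Γ(X, X.basicOpen f)] Γ(N, X.basicOpen f) :=
    ((presheafTensorObj M N).presheaf.map (homOfLE (X.basicOpen_le f)).op).hom
  exact exists_pow_smul_eq_zero_of_tensor_localization (A := Γ(X, X.basicOpen f)) f ρM ρN ψ
    (fun m n ↦ presheafTensorObj_map_tmul M N (X.basicOpen_le f) m n) t ht

theorem lTensor_injective_of_mono_tensorFunctor_map {M N N' : X.Modules} (φ : N ⟶ N')
    [Mono ((tensorFunctor M).map φ)] {U : X.Opens} (hU : IsAffineOpen U)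
    (hM : IsLocalizingOn M U) (hN : IsLocalizingOn N U) :
    Function.Injective ((appLin φ U).lTensor Γ(M, U)) := by
  rw [injective_iff_map_eq_zero]
  intro t ht
  have : Mono ((sheafify X).map (presheafTensorMap M φ)) :=
    inferInstanceAs (Mono ((tensorFunctor M).map φ))
  let s : Set Γ(X, U) := {f | ∃ n : ℕ, f ^ n • t = 0}
  have hs : Ideal.span s = ⊤ := by
    rw [← hU.iSup_basicOpen_eq_self_iff]
    refine le_antisymm (iSup_le fun f ↦ X.basicOpen_le _) fun x hx ↦ ?_
    obtain ⟨V, hV, hxV, h0⟩ := exists_map_eq_zero_of_mono_sheafify_map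
      (presheafTensorMap M φ) t ht hx
    obtain ⟨f, hfV, hxf⟩ := hU.exists_basicOpen_le ⟨x, hxV⟩ hx
    refine TopologicalSpace.Opens.mem_iSup.2 ⟨⟨f, ?_⟩, hxf⟩
    refine exists_pow_smul_eq_zero_of_map_eq_zero hU hM hN f t ?_
    have h1 : (presheafTensorObj M N).presheaf.map (homOfLE (X.basicOpen_le f)).op =
        (presheafTensorObj M N).presheaf.map (homOfLE hV).op ≫
          (presheafTensorObj M N).presheaf.map (homOfLE hfV).op := by
      rw [← Functor.map_comp]; rfl
    exact congr($h1 t).trans ((congr_arg _ h0).trans (map_zero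
      ((presheafTensorObj M N).presheaf.map (homOfLE hfV).op).hom))
  let I : Ideal Γ(X, U) := LinearMap.ker (LinearMap.toSpanSingleton Γ(X, U) _ t)
  have hI : I.radical = ⊤ := by
    rw [← top_le_iff, ← hs, Ideal.span_le]
    rintro f ⟨n, hn⟩
    exact ⟨n, hn⟩
  rw [Ideal.radical_eq_top, Ideal.eq_top_iff_one] at hI
  simpa [I] using hI

end Tensor
end
end QcohPurity

namespace QcohPurity

noncomputable section

section Exactness

open TensorProduct

variable {X : Scheme.{u}}

theorem presheafTensorMap_add (M : X.Modules) {N N' : X.Modules} (φ ψ : N ⟶ N') :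
    presheafTensorMap M (φ + ψ) = presheafTensorMap M φ + presheafTensorMap M ψ := by
  apply PresheafOfModules.hom_ext
  intro U
  apply ModuleCat.hom_ext
  refine LinearMap.ext fun t ↦ ?_
  exact LinearMap.congr_fun
    (LinearMap.lTensor_add Γ(M, U.unop) (appLin φ U.unop) (appLin ψ U.unop)) t

instance (M : X.Modules) : (tensorFunctor M).Additive where
  map_add {_ _ φ ψ} :=
    (congr_arg (sheafify X).map (presheafTensorMap_add M φ ψ)).trans (Functor.map_add _)

/-- The sheafification of a sheaf is isomorphic to it. -/
def sheafifyIso : Scheme.Modules.toPresheafOfModules X ⋙ sheafify X ≅ 𝟭 X.Modules :=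
  @asIso (X.Modules ⥤ X.Modules) _ _ _
    (PresheafOfModules.sheafificationAdjunction (𝟙 X.ringCatSheaf.obj)).counit
    (inferInstanceAs (IsIso
      (PresheafOfModules.sheafificationAdjunction (𝟙 X.ringCatSheaf.obj)).counit))

theorem exists_app_eq_map_of_epi {M N : X.Modules} (φ : M ⟶ N) [Epi φ] {U : X.Opens}
    (t : Γ(N, U)) {x : X} (hx : x ∈ U) :
    ∃ (V : X.Opens) (hV : V ≤ U), x ∈ V ∧ ∃ s : Γ(M, V),
      φ.app V s = N.presheaf.map (homOfLE hV).op t := by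
  have : Epi ((sheafify X).map ((Scheme.Modules.toPresheafOfModules X).map φ)) :=
    ((MorphismProperty.epimorphisms X.Modules).arrow_mk_iso_iff
      (((Functor.mapArrowFunctor _ _).mapIso sheafifyIso).app (Arrow.mk φ))).2 ‹Epi φ›
  exact exists_app_eq_map_of_epi_sheafify_map ((Scheme.Modules.toPresheafOfModules X).map φ) t hx

theorem epi_of_exists_app_eq_map {M N : X.Modules} (φ : M ⟶ N)
    (h : ∀ (U : X.Opens) (t : Γ(N, U)) (x : X), x ∈ U →
      ∃ (V : X.Opens) (hV : V ≤ U), x ∈ V ∧ ∃ s : Γ(M, V),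
        φ.app V s = N.presheaf.map (homOfLE hV).op t) : Epi φ :=
  ((MorphismProperty.epimorphisms X.Modules).arrow_mk_iso_iff
    (((Functor.mapArrowFunctor _ _).mapIso sheafifyIso).app (Arrow.mk φ))).1
    (epi_sheafify_map ((Scheme.Modules.toPresheafOfModules X).map φ) h)

theorem map_homOfLE_trans (P : X.PresheafOfModules) {U V W : X.Opens} (h : V ≤ U) (h' : W ≤ V)
    (t : P.obj (op U)) :
    P.map (homOfLE (h'.trans h)).op t = P.map (homOfLE h').op (P.map (homOfLE h).op t) :=
  congr($(P.presheaf.map_comp (homOfLE h).op (homOfLE h').op) t)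

theorem epi_tensorFunctor_map (M : X.Modules) {N N' : X.Modules} (φ : N ⟶ N') [Epi φ] :
    Epi ((tensorFunctor M).map φ) := by
  refine epi_sheafify_map (presheafTensorMap M φ) fun U t x hx ↦ ?_
  change Γ(M, U) ⊗[Γ(X, U)] Γ(N', U) at t
  induction t with
  | zero =>
    exact ⟨U, le_rfl, hx, 0, (map_zero ((presheafTensorMap M φ).app (op U)).hom).trans
      (map_zero ((presheafTensorObj M N').presheaf.map (homOfLE le_rfl).op).hom).symm⟩
  | tmul m n =>
    obtain ⟨V, hV, hxV, s, hs⟩ := exists_app_eq_map_of_epi φ n hx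
    refine ⟨V, hV, hxV, M.presheaf.map (homOfLE hV).op m ⊗ₜ[Γ(X, V)] s, ?_⟩
    exact congr_arg (fun z ↦ M.presheaf.map (homOfLE hV).op m ⊗ₜ[Γ(X, V)] z) hs
  | add t t' h h' =>
    obtain ⟨V, hV, hxV, s, hs⟩ := h
    obtain ⟨V', hV', hxV', s', hs'⟩ := h'
    have e : V ⊓ V' ≤ V := inf_le_left
    have e' : V ⊓ V' ≤ V' := inf_le_right
    have key {W : X.Opens} (hW : W ≤ U) (hWV : V ⊓ V' ≤ W) (t : (presheafTensorObj M N').obj (op U))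
        (s : (presheafTensorObj M N).obj (op W))
        (hs : (presheafTensorMap M φ).app (op W) s =
          (presheafTensorObj M N').map (homOfLE hW).op t) :
        ∃ s : (presheafTensorObj M N).obj (op (V ⊓ V')),
          (presheafTensorMap M φ).app (op (V ⊓ V')) s =
            (presheafTensorObj M N').map (homOfLE (e.trans hV)).op t :=
      ⟨(presheafTensorObj M N).map (homOfLE hWV).op s,
        (PresheafOfModules.naturality_apply (presheafTensorMap M φ) (homOfLE hWV).op s).trans
          ((congr_arg _ hs).trans (map_homOfLE_trans _ hW hWV t).symm)⟩
    obtain ⟨r, hr⟩ := key hV e t s hs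
    obtain ⟨r', hr'⟩ := key hV' e' t' s' hs'
    refine ⟨V ⊓ V', e.trans hV, ⟨hxV, hxV'⟩, r + r', ?_⟩
    exact (map_add ((presheafTensorMap M φ).app (op (V ⊓ V'))).hom _ _).trans
      ((congr_arg₂ (· + ·) hr hr').trans
        (map_add ((presheafTensorObj M N').presheaf.map (homOfLE (e.trans hV)).op).hom t t').symm)

theorem exact_map_tensorFunctor (M : X.Modules) (S : ShortComplex X.Modules)
    (h : ∀ U : X.Opens, IsAffineOpen U → Function.Exact ((appLin S.f U).lTensor Γ(M, U))
      ((appLin S.g U).lTensor Γ(M, U))) :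
    (S.map (tensorFunctor M)).Exact :=
  have h0 : presheafTensorMap M (0 : S.X₁ ⟶ S.X₃) = 0 := by
    simpa using presheafTensorMap_add M (0 : S.X₁ ⟶ S.X₃) 0
  have hz : presheafTensorMap M S.f ≫ presheafTensorMap M S.g = 0 := by
    rw [← h0, ← S.zero, presheafTensorMap, presheafTensorMap, ← Functor.map_comp,
      ← Functor.map_comp]
  exact_map_sheafify (ShortComplex.mk (presheafTensorMap M S.f) (presheafTensorMap M S.g) hz) h

theorem exactFunctor_tensorFunctor (F : X.Modules)
    (h : ∀ U : X.Opens, IsAffineOpen U → Module.Flat Γ(X, U) Γ(F, U)) :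
    exactFunctor X.Modules X.Modules (tensorFunctor F) := by
  have : ∀ S : ShortComplex X.Modules, S.ShortExact → (S.map (tensorFunctor F)).ShortExact := by
    intro S hS
    have := hS.mono_f
    have := hS.epi_g
    refine { exact := ?_, mono_f := ?_, epi_g := epi_tensorFunctor_map F S.g }
    · exact exact_map_tensorFunctor F S fun U hU ↦
        have := h U hU
        Module.Flat.lTensor_exact _ (exact_app hS.exact U)
    · exact mono_tensorFunctor_map F S.f fun U hU ↦
        have := h U hU
        Module.Flat.lTensor_preserves_injective_linearMap _ (app_injective_of_mono S.f U)
  exact ((Functor.exact_tfae (tensorFunctor F)).out 0 3).1 this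

end Exactness

end
end QcohPurity

namespace QcohPurity

noncomputable section

section FpFlat

variable {X : Scheme.{u}}

theorem exists_lift_relations {S : ShortComplex (Qcoh X)} {J : Type u} [SmallCategory J]
    [IsFiltered J] {D : J ⥤ Qcoh X} {c : Cocone D} (hc : IsColimit c) (e : c.pt ≅ S.X₃)
    (hlift : ∀ j (φ : D.obj j ⟶ S.X₃), ∃ ψ : D.obj j ⟶ S.X₂, ψ ≫ S.g = φ)
    {U : X.Opens} (hU : IsAffineOpen U) {l k : ℕ} (a : Fin l → Fin k → Γ(X, U))
    (y : Fin k → Γ(S.X₃.obj, U)) (hy : ∀ i, ∑ j, a i j • y j = 0) :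
    ∃ z : Fin k → Γ(S.X₂.obj, U), (∀ j, S.g.hom.app U (z j) = y j) ∧
      ∀ i, ∑ j, a i j • z j = 0 := by
  let Φ := Qcoh.incl X ⋙ sections U
  have : PreservesColimitsOfShape J Φ := preservesColimitsOfShape_sections hU
  have hc' := isColimitOfPreserves Φ hc
  have hcompat {p q : J} (f : p ⟶ q) (w : Γ((D.obj p).obj, U)) :
      (c.ι.app q ≫ e.hom).hom.app U ((D.map f).hom.app U w) =
        (c.ι.app p ≫ e.hom).hom.app U w := by
    rw [← c.w f]; rfl
  have hinj : Function.Injective (e.hom.hom.app U) :=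
    app_injective_of_mono ((Qcoh.incl X).map e.hom) U
  have hrep (y : Γ(S.X₃.obj, U)) : ∃ (p : J) (w : Γ((D.obj p).obj, U)),
      (c.ι.app p ≫ e.hom).hom.app U w = y := by
    obtain ⟨p, w, hw⟩ := Concrete.isColimit_exists_rep (D ⋙ Φ) hc' (e.inv.hom.app U y)
    exact ⟨p, w, (congr_arg (e.hom.hom.app U) hw).trans congr(($e.inv_hom_id).hom.app U y)⟩
  have hzero {p : J} (w : Γ((D.obj p).obj, U)) (hw : (c.ι.app p ≫ e.hom).hom.app U w = 0) :
      ∃ (q : J) (f : p ⟶ q), (D.map f).hom.app U w = 0 := by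
    obtain ⟨q, f, g, h⟩ := Concrete.isColimit_exists_of_rep_eq (D ⋙ Φ) hc'
      (i := p) (j := p) w (0 : Γ((D.obj p).obj, U)) (hinj (hw.trans
        (map_zero ((c.ι.app p ≫ e.hom).hom.app U).hom).symm))
    exact ⟨q, f, Eq.trans h (map_zero ((D.map g).hom.app U).hom)⟩
  have key : ∀ s : Finset (Fin l), ∃ (p : J) (w : Fin k → Γ((D.obj p).obj, U)),
      (∀ j, (c.ι.app p ≫ e.hom).hom.app U (w j) = y j) ∧ ∀ i ∈ s, ∑ j, a i j • w j = 0 := by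
    classical
    intro s
    induction s using Finset.induction_on with
    | empty =>
      choose p w hw using fun j ↦ hrep (y j)
      obtain ⟨q, hq⟩ := IsFiltered.sup_objs_exists (Finset.univ.image p)
      let f (j : Fin k) : p j ⟶ q := Classical.choice <| hq (Finset.mem_image_of_mem p (Finset.mem_univ j))
      exact ⟨q, fun j ↦ (D.map (f j)).hom.app U (w j), fun j ↦ (hcompat _ _).trans (hw j), by simp⟩
    | insert i s _ h =>
      obtain ⟨p, w, hw, hs⟩ := h
      have hsum {M : X.Modules} (φ : (D.obj p).obj ⟶ M) (i : Fin l) :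
          φ.app U (∑ j, a i j • w j) = ∑ j, a i j • φ.app U (w j) := by
        simp
      obtain ⟨q, f, hf⟩ := hzero (∑ j, a i j • w j) (by simpa only [hsum, hw] using hy i)
      refine ⟨q, fun j ↦ (D.map f).hom.app U (w j), fun j ↦ (hcompat _ _).trans (hw j), ?_⟩
      intro i' hi'
      rw [← hsum]
      obtain rfl | hi' := Finset.mem_insert.1 hi'
      · exact hf
      · rw [hs i' hi', map_zero]
  obtain ⟨p, w, hw, hw'⟩ := key Finset.univ
  obtain ⟨ψ, hψ⟩ := hlift p (c.ι.app p ≫ e.hom)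
  refine ⟨fun j ↦ ψ.hom.app U (w j), fun j ↦ ?_, fun i ↦ ?_⟩
  · rw [← hw, ← hψ]; rfl
  · have := congr_arg (appLin ψ.hom U) (hw' i (Finset.mem_univ i))
    simpa using this

theorem flatFp_subset_flatTensor (hX : IsLocallyFinitelyPresented (Qcoh X)) :
    FlatFp X ⊆ FlatTensor X := by
  rintro F hF S hS rfl
  refine ⟨hS, fun M ↦ mono_tensorFunctor_map M _ fun U hU ↦ ?_⟩
  obtain ⟨J, _, _, D, c, hc, hD, ⟨e⟩⟩ := hX.exists_isColimit S.X₃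
  have hS' := shortExact_incl hS
  have := hS'.mono_f
  refine lTensor_injective_of_lift_relations (appLin S.f.hom U) (appLin S.g.hom U)
    (app_injective_of_mono (S.map (Qcoh.incl X)).f U) (exact_app hS'.exact U) ?_ _
  intro l k a y hy
  refine exists_lift_relations hc e ?_ hU a _ hy
  intro j φ
  have := ((hF S hS rfl).2 (D.obj j) (hD j)).epi_g
  exact (AddCommGrpCat.epi_iff_surjective _).1 this φ

end FpFlat

end
end QcohPurity

namespace QcohPurity

noncomputable section

section AffineExtension

variable {X : Scheme.{u}} {U : X.Opens} (hU : IsAffineOpen U)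

/-- The tilde functor, with values in quasi-coherent sheaves. -/
def tildeQcoh (R : CommRingCat.{u}) : ModuleCat.{u} R ⥤ Qcoh (Spec R) :=
  (qcoh (Spec R)).lift (tilde.functor R) fun M ↦
    inferInstanceAs (tilde M).IsQuasicoherent

instance (R : CommRingCat.{u}) : (tildeQcoh R).IsEquivalence where
  full :=
    have : (tildeQcoh R ⋙ Qcoh.incl (Spec R)).Full := inferInstanceAs (tilde.functor R).Full
    Functor.Full.of_comp_faithful (tildeQcoh R) (Qcoh.incl (Spec R))
  faithful :=
    have : (tildeQcoh R ⋙ Qcoh.incl (Spec R)).Faithful :=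
      inferInstanceAs (tilde.functor R).Faithful
    Functor.Faithful.of_comp (tildeQcoh R) (Qcoh.incl (Spec R))
  essSurj :=
    ⟨fun M ↦
      have := M.property
      ⟨_, ⟨(qcoh (Spec R)).isoMk (@asIso _ _ _ _ M.obj.fromTildeΓ
        (Scheme.Modules.isIso_fromTildeΓ_of_isQuasicoherent M.obj))⟩⟩⟩

instance (R : CommRingCat.{u}) : PreservesFiniteLimits (tilde.functor R) :=
  inferInstanceAs (PreservesFiniteLimits (tildeQcoh R ⋙ Qcoh.incl (Spec R)))

/-- The direct image of the quasi-coherent sheaf associated with a module over `Γ(X, U)`. -/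
abbrev affineExtension : ModuleCat.{u} Γ(X, U) ⥤ X.Modules :=
  tilde.functor Γ(X, U) ⋙ Scheme.Modules.pushforward hU.fromSpec

theorem isQuasicoherent_affineExtension (hX : IsSemiSeparated X) (N : ModuleCat.{u} Γ(X, U)) :
    ((affineExtension hU).obj N).IsQuasicoherent :=
  isQuasicoherent_pushforward_fromSpec hX hU (tilde N)

theorem toOpen_bijective_of_eq_top {R : CommRingCat.{u}} (N : ModuleCat.{u} R)
    {V : (Spec R).Opens} (hV : V = ⊤) : Function.Bijective (tilde.toOpen N V).hom := by
  subst hV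
  exact ConcreteCategory.bijective_of_isIso (tilde.toOpen N ⊤)

theorem smul_eq_fromSpec_app_smul (M : (Spec Γ(X, U)).Modules) (r : Γ(X, U))
    (x : Γ(M, hU.fromSpec ⁻¹ᵁ U)) : r • x = hU.fromSpec.app U r • x := by
  rw [Scheme.Modules.smul_Spec_def, hU.fromSpec_app_self]
  rfl

/-- The canonical map from a module over `Γ(X, U)` to the sections of its `affineExtension`. -/
def toAffineExtension (N : ModuleCat.{u} Γ(X, U)) :
    N →ₗ[Γ(X, U)] Γ((affineExtension hU).obj N, U) where
  toFun x := (tilde.toOpen N (hU.fromSpec ⁻¹ᵁ U)).hom x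
  map_add' := map_add (tilde.toOpen N (hU.fromSpec ⁻¹ᵁ U)).hom
  map_smul' r x := ((tilde.toOpen N (hU.fromSpec ⁻¹ᵁ U)).hom.map_smul r x).trans
    (smul_eq_fromSpec_app_smul hU (tilde N) r ((tilde.toOpen N (hU.fromSpec ⁻¹ᵁ U)).hom x))

/-- The sections of `affineExtension` over `U`. -/
def affineExtensionEquiv (N : ModuleCat.{u} Γ(X, U)) :
    N ≃ₗ[Γ(X, U)] Γ((affineExtension hU).obj N, U) :=
  LinearEquiv.ofBijective (toAffineExtension hU N)
    (toOpen_bijective_of_eq_top N hU.fromSpec_preimage_self)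

theorem affineExtensionEquiv_naturality {N N' : ModuleCat.{u} Γ(X, U)} (f : N ⟶ N') (x : N) :
    appLin ((affineExtension hU).map f) U (affineExtensionEquiv hU N x) =
      affineExtensionEquiv hU N' (f x) :=
  congr($(tilde.toOpen_map_app f (hU.fromSpec ⁻¹ᵁ U)) x)

theorem flat_of_preservesMonomorphisms_tensorFunctor (hX : IsSemiSeparated X) (F : X.Modules)
    [F.IsQuasicoherent] [(tensorFunctor F).PreservesMonomorphisms] (hU : IsAffineOpen U) :
    Module.Flat Γ(X, U) Γ(F, U) := by
  rw [Module.Flat.iff_lTensor_injective']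
  intro I
  let f : ModuleCat.of Γ(X, U) I ⟶ ModuleCat.of Γ(X, U) Γ(X, U) := ModuleCat.ofHom I.subtype
  have : Mono f := (ModuleCat.mono_iff_injective f).2 I.subtype_injective
  have hI : IsLocalizingOn ((affineExtension hU).obj (ModuleCat.of Γ(X, U) I)) U :=
    have := isQuasicoherent_affineExtension hU hX (ModuleCat.of Γ(X, U) I)
    .of_isQuasicoherent _ hU
  have h := lTensor_injective_of_mono_tensorFunctor_map (M := F) ((affineExtension hU).map f) hU
    (.of_isQuasicoherent _ hU) hI
  have hcomm : (affineExtensionEquiv hU _).toLinearMap ∘ₗ f.hom =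
      appLin ((affineExtension hU).map f) U ∘ₗ (affineExtensionEquiv hU _).toLinearMap :=
    LinearMap.ext fun x ↦ (affineExtensionEquiv_naturality hU f x).symm
  have h' : Function.Injective
      ((affineExtensionEquiv hU _).toLinearMap.lTensor Γ(F, U) ∘ₗ f.hom.lTensor Γ(F, U)) := by
    rw [← LinearMap.lTensor_comp, hcomm, LinearMap.lTensor_comp, LinearMap.coe_comp]
    exact h.comp (LinearEquiv.lTensor Γ(F, U) (affineExtensionEquiv hU _)).injective
  exact Function.Injective.of_comp h'

theorem flat_subset_flatTensor (hX : IsSemiSeparated X) : Flat X ⊆ FlatTensor X := by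
  rintro F hF S hS rfl
  have hS' := shortExact_incl hS
  have := hS'.mono_f
  have := hS.epi_g
  have : PreservesFiniteLimits (tensorFunctor S.X₃.obj) := hF.1
  have := S.X₃.property
  refine ⟨hS, fun M ↦ mono_tensorFunctor_map M _ fun U hU ↦ ?_⟩
  have := flat_of_preservesMonomorphisms_tensorFunctor hX S.X₃.obj hU
  exact LinearMap.lTensor_injective_of_exact_of_flat (appLin S.g.hom U)
    (app_surjective_of_epi hU S.g) (appLin S.f.hom U)
    (app_injective_of_mono (S.map (Qcoh.incl X)).f U) (exact_app hS'.exact U) _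

end AffineExtension

end
end QcohPurity

namespace QcohPurity

noncomputable section

section TensorFlat

variable {X : Scheme.{u}}

instance : (qcoh X).ContainsZero where
  exists_zero := by
    obtain ⟨Z, hZ⟩ := HasZeroObject.zero (C := X.Modules)
    refine ⟨Z, hZ, isQuasicoherent_of_isLocalizingOn _ fun U _ ↦ ?_⟩
    have (V : X.Opens) (x : Γ(Z, V)) : x = 0 :=
      congr($(((sections V).map_isZero hZ).eq_of_src (𝟙 _) 0) x)
    exact ⟨fun f s ↦ ⟨0, 0, (this _ _).trans (this _ _).symm⟩, fun f t _ ↦ ⟨0, this _ _⟩⟩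

instance : (qcoh X).IsClosedUnderKernels where
  kernels_le := by
    rintro _ ⟨f, k, hk, hf⟩
    exact (qcoh X).prop_of_isLimit hk (by rintro (_ | _); exacts [hf.1, hf.2])

instance : (qcoh X).IsClosedUnderCokernels where
  cokernels_le := by
    rintro _ ⟨f, k, hk, hf⟩
    have : (qcoh X).IsClosedUnderColimitsOfShape WalkingParallelPair :=
      .of_equivalence
        (AsSmall.equiv : WalkingParallelPair ≌ AsSmall.{u} WalkingParallelPair).symm
    exact (qcoh X).prop_of_isColimit hk (by rintro (_ | _); exacts [hf.1, hf.2])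

instance : (qcoh X).IsClosedUnderFiniteProducts where
  isClosedUnderLimitsOfShape J _ :=
    have := Fintype.ofFinite J
    have := Classical.decEq J
    inferInstance

instance : Abelian (Qcoh X) := inferInstanceAs (Abelian (qcoh X).FullSubcategory)

theorem shortExact_kernel {G F : Qcoh X} (g : G ⟶ F) [Epi g] :
    (ShortComplex.mk (kernel.ι g) g (kernel.condition g)).ShortExact where
  exact := ShortComplex.exact_kernel g

variable {U : X.Opens} (hU : IsAffineOpen U)

theorem exists_epi_flat {R : CommRingCat.{u}} (N : ModuleCat.{u} R) :
    ∃ (P : ModuleCat.{u} R) (q : P ⟶ N), Epi q ∧ Module.Flat R P :=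
  ⟨ModuleCat.of R (N →₀ R), ModuleCat.ofHom (Finsupp.linearCombination R id),
    (ModuleCat.epi_iff_surjective _).2 (Finsupp.linearCombination_id_surjective _ _),
    inferInstanceAs (Module.Flat R (N →₀ R))⟩

theorem epi_of_app_surjective {F G : Qcoh X} (φ : F ⟶ G)
    (h : ∀ U : X.Opens, IsAffineOpen U → Function.Surjective (φ.hom.app U)) : Epi φ :=
  (Qcoh.incl X).epi_of_epi_map <| epi_of_exists_app_eq_map _ fun _ _ _ hx ↦
    have ⟨V, hV, hxV, hVU⟩ := exists_affine_le hx
    ⟨V, hVU, hxV, h V hV _⟩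

theorem isIso_unit_app_app (M : X.Modules) :
    IsIso (((Scheme.Modules.restrictAdjunction hU.fromSpec).unit.app M).app U) := by
  have h : hU.fromSpec ''ᵁ (hU.fromSpec ⁻¹ᵁ U) = U := by
    rw [hU.fromSpec_preimage_self, ← eq_fromSpec_image_top hU]
  rw [Scheme.Modules.restrictAdjunction_unit_app_app]
  exact inferInstanceAs (IsIso (M.presheaf.map (eqToHom h).op))

theorem exists_epi_flat_sections (hX : IsSemiSeparated X) (hU : IsAffineOpen U) (F : Qcoh X) :
    ∃ (G : Qcoh X) (g : G ⟶ F), Epi g ∧ Module.Flat Γ(X, U) Γ(G.obj, U) := by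
  obtain ⟨P, q, _, _⟩ := exists_epi_flat ((affineSections hU).obj F)
  have := F.property
  have hF : (F.obj.restrict hU.fromSpec).IsQuasicoherent :=
    Scheme.Modules.isQuasicoherent_restrictFunctor hU.fromSpec F.obj
  let a : (tildeQcoh Γ(X, U)).obj P ⟶ ⟨F.obj.restrict hU.fromSpec, hF⟩ :=
    ObjectProperty.homMk (tilde.map q ≫ (affineSectionsTildeIso hU).hom.app F)
  have : Epi a := by
    have : Epi ((tilde.functor Γ(X, U)).map q) := inferInstance
    have : Epi ((Qcoh.incl (Spec Γ(X, U))).map a) := epi_comp ((tilde.functor Γ(X, U)).map q)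
      ((affineSectionsTildeIso hU).hom.app F)
    exact (Qcoh.incl (Spec Γ(X, U))).epi_of_epi_map this
  let B : Qcoh X := ⟨(affineExtension hU).obj P, isQuasicoherent_affineExtension hU hX P⟩
  let C : Qcoh X := ⟨(Scheme.Modules.pushforward hU.fromSpec).obj (F.obj.restrict hU.fromSpec),
    isQuasicoherent_pushforward_fromSpec hX hU _⟩
  let b : B ⟶ C := ObjectProperty.homMk ((Scheme.Modules.pushforward hU.fromSpec).map a.hom)
  let η : F ⟶ C :=
    ObjectProperty.homMk ((Scheme.Modules.restrictAdjunction hU.fromSpec).unit.app F.obj)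
  have hpb (V : X.Opens) := (IsPullback.of_hasPullback b η).map (Qcoh.incl X ⋙ sections V)
  refine ⟨pullback b η, pullback.snd b η, epi_of_app_surjective _ fun V hV ↦ ?_, ?_⟩
  · have : Epi ((Qcoh.incl X ⋙ sections V).map b) := (AddCommGrpCat.epi_iff_surjective _).2
      (app_surjective_of_epi (isAffineOpen_fromSpec_preimage hX hU hV) a)
    exact (AddCommGrpCat.epi_iff_surjective _).1
      ((MorphismProperty.epimorphisms Ab.{u}).of_isPullback (hpb V) this)
  · have : IsIso ((Qcoh.incl X ⋙ sections U).map η) := isIso_unit_app_app hU F.obj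
    have hiso := (hpb U).isIso_fst_of_isIso
    have : Module.Flat Γ(X, U) Γ(B.obj, U) := .of_linearEquiv (affineExtensionEquiv hU P).symm
    exact .of_linearEquiv (LinearEquiv.ofBijective (appLin (pullback.fst b η).hom U)
      (ConcreteCategory.bijective_of_isIso ((Qcoh.incl X ⋙ sections U).map (pullback.fst b η))))

theorem flatTensor_subset_flat (hX : IsSemiSeparated X) : FlatTensor X ⊆ Flat X := by
  intro F hF
  refine exactFunctor_tensorFunctor F.obj fun U hU ↦ ?_
  obtain ⟨G, g, _, _⟩ := exists_epi_flat_sections hX hU F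
  have hS := shortExact_kernel g
  have hpure := (hF _ hS rfl).2
  have hS' := shortExact_incl hS
  have := hS'.mono_f
  refine flat_of_lTensor_quotient_injective (appLin (kernel.ι g).hom U) (appLin g.hom U)
    (exact_app hS'.exact U) (app_surjective_of_epi hU g) fun I ↦ ?_
  let Q := ModuleCat.of Γ(X, U) (Γ(X, U) ⧸ I)
  have := isQuasicoherent_affineExtension hU hX Q
  have : ((Qcoh.incl X).obj (kernel g)).IsQuasicoherent := (kernel g).property
  have := hpure ((affineExtension hU).obj Q)
  have h := lTensor_injective_of_mono_tensorFunctor_map (M := (affineExtension hU).obj Q)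
    ((Qcoh.incl X).map (kernel.ι g)) hU (.of_isQuasicoherent _ hU) (.of_isQuasicoherent _ hU)
  let e : (Γ(X, U) ⧸ I) ≃ₗ[Γ(X, U)] Γ((affineExtension hU).obj Q, U) := affineExtensionEquiv hU Q
  have hcomm : (appLin (kernel.ι g).hom U).lTensor Γ((affineExtension hU).obj Q, U) ∘ₗ
      e.toLinearMap.rTensor Γ((kernel g).obj, U) =
      e.toLinearMap.rTensor Γ(G.obj, U) ∘ₗ (appLin (kernel.ι g).hom U).lTensor (Γ(X, U) ⧸ I) := by
    rw [LinearMap.lTensor_comp_rTensor, LinearMap.rTensor_comp_lTensor]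
  refine Function.Injective.of_comp (f := e.toLinearMap.rTensor Γ(G.obj, U)) ?_
  rw [← LinearMap.coe_comp, ← hcomm, LinearMap.coe_comp]
  exact h.comp (LinearEquiv.rTensor Γ((kernel g).obj, U) e).injective

end TensorFlat

end
end QcohPurity

theorem mainTheorem6 (X : Scheme.{u})
    (hX : QcohPurity.IsLocallyFinitelyPresented (QcohPurity.Qcoh X)) :
    QcohPurity.FlatFp X ⊆ QcohPurity.FlatTensor X ∧
      (QcohPurity.IsSemiSeparated X →
        QcohPurity.FlatFp X ⊆ QcohPurity.FlatTensor X ∧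
          QcohPurity.FlatTensor X = QcohPurity.Flat X) := by
  exact ⟨QcohPurity.flatFp_subset_flatTensor hX, fun h ↦
    ⟨QcohPurity.flatFp_subset_flatTensor hX,
      (QcohPurity.flatTensor_subset_flat h).antisymm (QcohPurity.flat_subset_flatTensor h)⟩⟩
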